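/- Let $\Gamma$ be an infinite connected metric graph (loops and multiple edges are allowed) in which every vertex has finite positive degree. Each edge $e$ is identified with a segment $[0,l_e]$, and the edge lengths satisfy $l_0\le l_e\le L$ for some constants $0<l_0\le L<\infty$. Let $o$ be a root vertex, let $\rho$ be the path metric of $\Gamma$, and let $B_r=\{x\in\Gamma : \rho(o,x)\le r\}$. At each vertex $v$ let a self-adjoint vertex condition be given. That is, let $d_v$ be the degree of $v$ (a loop counts twice), and let $W_v\subset\mathbb{C}^{d_v}\times\mathbb{C}^{d_v}$ be a linear subspace which is Lagrangian: it equals the set of all $(F,G)$ such that $\sum_{a}\bigl(F_a\overline{G'_a}-G_a\overline{F'_a}\bigr)=0$ for all $(F',G')\in W_v$. A function $f$ on $\Gamma$ that belongs to $H^2(e)$ on each edge $e$ satisfies the condition at $v$ if $(F,G)\in W_v$, where $F$ is the vector of the boundary values of $f$ at $v$ along the edge-ends at $v$, and $G$ is the vector of the derivatives of $f$ at $v$ along these edge-ends in the directions pointing away from $v$. Let $H$ be the operator $-\frac{d^2}{dx^2}$ in $L^2(\Gamma)$ whose domain consists of all $f\in L^2(\Gamma)$ that belong to $H^2(e)$ on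 each edge $e$, satisfy all vertex conditions, and have $f''\in L^2(\Gamma)$. Suppose that the volume of $B_r$ grows sub-exponentially: for every $\epsilon>0$ there is a constant $C_\epsilon$ such that the total length of $B_r$ is at most $C_\epsilon e^{\epsilon r}$ for all $r\ge 0$. Let $\lambda\in\mathbb{R}$, and suppose that there is a bounded function $\varphi$ on $\Gamma$, not identically zero, that belongs to $H^2(e)$ on each edge $e$, satisfies all vertex conditions, and solves $-\varphi''=\lambda\varphi$ almost everywhere on $\Gamma$. Then $\lambda\in\sigma(H)$. -/

import Mathlib

open MeasureTheory Set

noncomputable section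

namespace QuantumGraphs

/-- A connected metric graph. Loops and multiple edges are allowed. The edge `e` is identified with
the segment `[0, len e]`; its end `x = 0` is attached to the vertex `endpt e false` and its end
`x = len e` to the vertex `endpt e true`. An edge-end is a pair `(e, b)`, so that a loop contributes
two ends to its vertex. Every vertex has finite and positive degree. (Countability of the sets of
vertices and edges follows from connectedness and the finiteness of the degrees.) -/
structure MetricGraph (V E : Type*) where
  /-- the vertex to which each of the two ends of an edge is attached -/
  endpt : E → Bool → V
  /-- the length of an edge -/
  len : E → ℝ
  len_pos : ∀ e, 0 < len e
  finite_ends : ∀ v, Finite {a : E × Bool // endpt a.1 a.2 = v}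
  nonempty_ends : ∀ v, Nonempty {a : E × Bool // endpt a.1 a.2 = v}
  connected : ∀ u v, Relation.ReflTransGen
    (fun x y => ∃ e b, endpt e b = x ∧ endpt e (!b) = y) u v

variable {V E : Type*}

namespace MetricGraph

variable (Γ : MetricGraph V E)

/-- The edge-ends attached to the vertex `v`. -/
abbrev Ends (v : V) : Type _ := {a : E × Bool // Γ.endpt a.1 a.2 = v}

/-- The edge lengths are bounded below and above by finite positive constants. -/
def ConditionA : Prop := ∃ l₀ L : ℝ, 0 < l₀ ∧ ∀ e, l₀ ≤ Γ.len e ∧ Γ.len e ≤ L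

/-- `Γ.IsWalk u v s`: there is a walk along edges, of total length `s`, from `u` to `v`. -/
inductive IsWalk (u : V) : V → ℝ → Prop
  | nil : IsWalk u u 0
  | snoc (e : E) (b : Bool) (s : ℝ) (h : IsWalk u (Γ.endpt e b) s) :
      IsWalk u (Γ.endpt e (!b)) (s + Γ.len e)

/-- The segment `[0, len e]` which represents the edge `e`. -/
abbrev segment (e : E) : Set ℝ := Icc 0 (Γ.len e)

/-- The distance, along the edge `e`, of the point with coordinate `x` to the end `b` of `e`. -/
def distToEnd (e : E) (b : Bool) (x : ℝ) : ℝ := if b then Γ.len e - x else x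

/-- The metric `ρ(o, ·)` of the graph: the distance from the vertex `o` to the point of the edge
`e` with coordinate `x` is the infimum of the lengths of the paths that join them, that is, of the
paths which consist of a walk to an end of `e` and the piece of `e` from that end to the point. -/
def rho (o : V) (e : E) (x : ℝ) : ℝ :=
  sInf {t | ∃ b s, Γ.IsWalk o (Γ.endpt e b) s ∧ t = s + Γ.distToEnd e b x}

/-- The part, in the edge `e`, of the closed ball `B_r` of radius `r` about the root `o`. -/
def ballOn (o : V) (r : ℝ) (e : E) : Set ℝ := {x | x ∈ Γ.segment e ∧ Γ.rho o e x ≤ r}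

/-- The Lebesgue measure (total length) of the ball `B_r` about the root `o`. -/
def ballVolume (o : V) (r : ℝ) : ENNReal := ∑' e, volume (Γ.ballOn o r e)

/-- The volume of `B_r` grows sub-exponentially:
for every `ε > 0` it is at most `C_ε e ^ (ε r)` for all `r`. -/
def SubexponentialGrowth (o : V) : Prop :=
  ∀ ε : ℝ, 0 < ε → ∃ C : ℝ, ∀ r : ℝ, 0 ≤ r →
    Γ.ballVolume o r ≤ ENNReal.ofReal (C * Real.exp (ε * r))

/-- Lebesgue measure on the edge `e`. -/
abbrev edgeMeasure (e : E) : Measure ℝ := volume.restrict (Γ.segment e)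

/-- The Hilbert space `L²(Γ)`, the Hilbert sum of the spaces `L²(0, len e)` of the edges. -/
abbrev L2 : Type _ := lp (fun e => Lp ℂ 2 (Γ.edgeMeasure e)) 2

/-- A function on the graph that belongs to the Sobolev space `H²` on each edge, together with its
first and second derivative along the edges. On `[0, len e]`, the function is continuously
differentiable, and its derivative is absolutely continuous and is the primitive of a function in
`L²`. (This is `H²` in dimension one, each class being represented by its continuously
differentiable representative.) Values outside `[0, len e]` are irrelevant. -/
structure EdgewiseH2 where
  toFun : E → ℝ → ℂ
  /-- the first derivative -/
  deriv₁ : E → ℝ → ℂ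
  /-- the second derivative, determined almost everywhere -/
  deriv₂ : E → ℝ → ℂ
  memLp_deriv₂ : ∀ e, MemLp (deriv₂ e) 2 (Γ.edgeMeasure e)
  toFun_eq : ∀ e, ∀ x ∈ Γ.segment e, toFun e x = toFun e 0 + ∫ t in (0 : ℝ)..x, deriv₁ e t
  deriv₁_eq : ∀ e, ∀ x ∈ Γ.segment e, deriv₁ e x = deriv₁ e 0 + ∫ t in (0 : ℝ)..x, deriv₂ e t

variable {Γ}

namespace EdgewiseH2

/-- The value of the function at an edge-end of the vertex `v`. -/
def valueAt (f : Γ.EdgewiseH2) (v : V) (a : Γ.Ends v) : ℂ :=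
  if a.1.2 then f.toFun a.1.1 (Γ.len a.1.1) else f.toFun a.1.1 0

/-- The derivative at an edge-end of the vertex `v`, in the direction away from `v`. -/
def outDerivAt (f : Γ.EdgewiseH2) (v : V) (a : Γ.Ends v) : ℂ :=
  if a.1.2 then -f.deriv₁ a.1.1 (Γ.len a.1.1) else f.deriv₁ a.1.1 0

end EdgewiseH2

variable (Γ)

/-- Self-adjoint vertex conditions: for each vertex `v`, a linear subspace `W_v` of
`ℂ ^ d_v × ℂ ^ d_v`, to which the vector of the values and the vector of the outgoing derivatives at
`v` have to belong, and which is Lagrangian: it equals its own orthogonal complement with respect to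
the boundary form `∑ a, (F a * conj (G' a) - G a * conj (F' a))` of `-d²/dx²`.
Equivalently, `W_v = {(F, G) | A F + B G = 0}` with `d_v × d_v` matrices `A`, `B` such that the
matrix `(A B)` has rank `d_v` and `A Bᴴ` is Hermitian. -/
structure SelfAdjointVertexConditions where
  space : ∀ v, Submodule ℂ ((Γ.Ends v → ℂ) × (Γ.Ends v → ℂ))
  mem_iff : ∀ v F G, (F, G) ∈ space v ↔ ∀ F' G', (F', G') ∈ space v →
    ∑ᶠ a, (F a * (starRingEnd ℂ) (G' a) - G a * (starRingEnd ℂ) (F' a)) = 0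

variable {Γ}

/-- The function `f` satisfies the vertex conditions `W` at all vertices. -/
def SelfAdjointVertexConditions.Holds (W : Γ.SelfAdjointVertexConditions)
    (f : Γ.EdgewiseH2) : Prop :=
  ∀ v, (f.valueAt v, f.outDerivAt v) ∈ W.space v

/-- `f` satisfies the equation `-f'' = lam f` almost everywhere on `Γ`. -/
def EdgewiseH2.IsSolution (f : Γ.EdgewiseH2) (lam : ℝ) : Prop :=
  ∀ e, ∀ᵐ x ∂(Γ.edgeMeasure e), -f.deriv₂ e x = (lam : ℂ) * f.toFun e x

/-- `f` is bounded on `Γ`. -/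
def EdgewiseH2.IsBounded (f : Γ.EdgewiseH2) : Prop :=
  ∃ M : ℝ, ∀ e, ∀ x ∈ Γ.segment e, ‖f.toFun e x‖ ≤ M

/-- `f` is not the zero function on `Γ`. -/
def EdgewiseH2.IsNonzero (f : Γ.EdgewiseH2) : Prop :=
  ∃ e, ∃ x ∈ Γ.segment e, f.toFun e x ≠ 0

/-! ### The Hamiltonian -/

section helpers

variable {l : ℝ} {f g h : ℝ → ℂ}

theorem continuousOn_of_primitive (hg : IntegrableOn g (Icc 0 l))
    (hf : ∀ x ∈ Icc 0 l, f x = f 0 + ∫ t in (0 : ℝ)..x, g t) : ContinuousOn f (Icc 0 l) := by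
  have h1 : ContinuousOn (fun x => f 0 + ∫ t in Ioc 0 x, g t) (Icc 0 l) :=
    continuousOn_const.add (intervalIntegral.continuousOn_primitive hg)
  refine h1.congr fun x hx => ?_
  rw [hf x hx, intervalIntegral.integral_of_le hx.1]

theorem ae_eq_zero_of_primitive (hl : 0 < l) (hg : IntegrableOn g (Icc 0 l))
    (hf : ∀ x ∈ Icc 0 l, f x = f 0 + ∫ t in (0 : ℝ)..x, g t) (hf0 : ∀ x ∈ Icc 0 l, f x = 0) :
    g =ᵐ[volume.restrict (Icc 0 l)] 0 := by
  have hint : IntervalIntegrable g volume 0 l := by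
    rw [intervalIntegrable_iff_integrableOn_Icc_of_le hl.le]
    exact hg
  rw [Measure.restrict_congr_set (Ioo_ae_eq_Icc (μ := volume) (a := (0 : ℝ)) (b := l)).symm]
  rw [Filter.EventuallyEq, ae_restrict_iff' measurableSet_Ioo]
  filter_upwards [hint.ae_hasDerivAt_integral] with x hx hxl
  have hxI : x ∈ uIcc 0 l := by rw [uIcc_of_le hl.le]; exact Ioo_subset_Icc_self hxl
  have h1 := hx hxI 0 left_mem_uIcc
  have h2 : HasDerivAt (fun y => ∫ t in (0 : ℝ)..y, g t) 0 x := by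
    refine (hasDerivAt_const x (0 : ℂ)).congr_of_eventuallyEq ?_
    filter_upwards [Icc_mem_nhds hxl.1 hxl.2] with y hy
    have h3 := hf y hy
    rw [hf0 y hy, hf0 0 ⟨le_rfl, hl.le⟩, zero_add] at h3
    exact h3.symm
  exact h1.unique h2

/-- On an edge, the second derivative is determined almost everywhere by the function. -/
theorem second_deriv_ae_zero (hl : 0 < l) (hh : MemLp h 2 (volume.restrict (Icc 0 l)))
    (hf : ∀ x ∈ Icc 0 l, f x = f 0 + ∫ t in (0 : ℝ)..x, g t)
    (hg : ∀ x ∈ Icc 0 l, g x = g 0 + ∫ t in (0 : ℝ)..x, h t)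
    (h0 : f =ᵐ[volume.restrict (Icc 0 l)] 0) : h =ᵐ[volume.restrict (Icc 0 l)] 0 := by
  have hhi : IntegrableOn h (Icc 0 l) := hh.integrable (by norm_num)
  have hgc := continuousOn_of_primitive hhi hg
  have hgi : IntegrableOn g (Icc 0 l) := hgc.integrableOn_Icc
  have hfc := continuousOn_of_primitive hgi hf
  have hf0 := Measure.eqOn_Icc_of_ae_eq (μ := volume) hl.ne h0 hfc continuousOn_const
  have hg0 := ae_eq_zero_of_primitive hl hgi hf hf0
  have hg1 := Measure.eqOn_Icc_of_ae_eq (μ := volume) hl.ne hg0 hgc continuousOn_const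
  exact ae_eq_zero_of_primitive hl hhi hg hg1

end helpers

theorem EdgewiseH2.integrableOn_deriv₂ (f : Γ.EdgewiseH2) (e : E) :
    IntegrableOn (f.deriv₂ e) (Γ.segment e) := (f.memLp_deriv₂ e).integrable (by norm_num)

theorem EdgewiseH2.integrableOn_deriv₁ (f : Γ.EdgewiseH2) (e : E) :
    IntegrableOn (f.deriv₁ e) (Γ.segment e) :=
  (continuousOn_of_primitive (f.integrableOn_deriv₂ e) (f.deriv₁_eq e)).integrableOn_Icc

theorem intervalIntegrable_of_segment {g : ℝ → ℂ} {l x : ℝ} (hg : IntegrableOn g (Icc 0 l))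
    (hx : x ∈ Icc 0 l) : IntervalIntegrable g volume 0 x := by
  rw [intervalIntegrable_iff_integrableOn_Icc_of_le hx.1]
  exact hg.mono_set (Icc_subset_Icc_right hx.2)

/-- The linear combination `f + c g`. -/
def EdgewiseH2.addSMul (f g : Γ.EdgewiseH2) (c : ℂ) : Γ.EdgewiseH2 where
  toFun e x := f.toFun e x + c * g.toFun e x
  deriv₁ e x := f.deriv₁ e x + c * g.deriv₁ e x
  deriv₂ e x := f.deriv₂ e x + c * g.deriv₂ e x
  memLp_deriv₂ e := (f.memLp_deriv₂ e).add ((g.memLp_deriv₂ e).const_mul c)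
  toFun_eq e x hx := by
    rw [intervalIntegral.integral_add
      (intervalIntegrable_of_segment (f.integrableOn_deriv₁ e) hx)
      ((intervalIntegrable_of_segment (g.integrableOn_deriv₁ e) hx).const_mul c),
      intervalIntegral.integral_const_mul, f.toFun_eq e x hx, g.toFun_eq e x hx]
    ring
  deriv₁_eq e x hx := by
    rw [intervalIntegral.integral_add
      (intervalIntegrable_of_segment (f.integrableOn_deriv₂ e) hx)
      ((intervalIntegrable_of_segment (g.integrableOn_deriv₂ e) hx).const_mul c),
      intervalIntegral.integral_const_mul, f.deriv₁_eq e x hx, g.deriv₁_eq e x hx]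
    ring

/-- The zero function. -/
def EdgewiseH2.zero : Γ.EdgewiseH2 where
  toFun _ _ := 0
  deriv₁ _ _ := 0
  deriv₂ _ _ := 0
  memLp_deriv₂ _ := MemLp.zero'
  toFun_eq := by simp
  deriv₁_eq := by simp

theorem SelfAdjointVertexConditions.holds_addSMul (W : Γ.SelfAdjointVertexConditions)
    {f g : Γ.EdgewiseH2} (c : ℂ) (hf : W.Holds f) (hg : W.Holds g) :
    W.Holds (f.addSMul g c) := by
  intro v
  have h := (W.space v).add_mem (hf v) ((W.space v).smul_mem c (hg v))
  convert h using 1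
  ext a
  · simp only [EdgewiseH2.valueAt, EdgewiseH2.addSMul, Prod.fst_add, Prod.smul_fst, Pi.add_apply,
      Pi.smul_apply, smul_eq_mul]
    split_ifs <;> rfl
  · simp only [EdgewiseH2.outDerivAt, EdgewiseH2.addSMul, Prod.snd_add, Prod.smul_snd, Pi.add_apply,
      Pi.smul_apply, smul_eq_mul]
    split_ifs <;> ring

theorem SelfAdjointVertexConditions.holds_zero (W : Γ.SelfAdjointVertexConditions) :
    W.Holds EdgewiseH2.zero := by
  intro v
  convert (W.space v).zero_mem using 1
  ext a <;> simp [EdgewiseH2.valueAt, EdgewiseH2.outDerivAt, EdgewiseH2.zero]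

/-- The pair `(u, w)` lies in the graph of the Hamiltonian: `u ∈ L²(Γ)` is (almost everywhere)
a function that is in `H²` on each edge and satisfies the vertex conditions, and `-u'' = w` with
`w ∈ L²(Γ)`. -/
def SelfAdjointVertexConditions.InGraph (W : Γ.SelfAdjointVertexConditions)
    (u w : Γ.L2) : Prop :=
  ∃ f : Γ.EdgewiseH2, W.Holds f ∧
    (∀ e, u e =ᵐ[Γ.edgeMeasure e] f.toFun e) ∧
    (∀ e, w e =ᵐ[Γ.edgeMeasure e] fun x => -f.deriv₂ e x)

theorem SelfAdjointVertexConditions.inGraph_addSMul (W : Γ.SelfAdjointVertexConditions)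
    {u w u' w' : Γ.L2} (c : ℂ) (h : W.InGraph u w) (h' : W.InGraph u' w') :
    W.InGraph (u + c • u') (w + c • w') := by
  obtain ⟨f, hf, hu, hw⟩ := h
  obtain ⟨g, hg, hu', hw'⟩ := h'
  refine ⟨f.addSMul g c, W.holds_addSMul c hf hg, fun e => ?_, fun e => ?_⟩
  · have h1 : (u + c • u') e = u e + c • u' e := rfl
    rw [h1]
    filter_upwards [Lp.coeFn_add (u e) (c • u' e), Lp.coeFn_smul c (u' e), hu e, hu' e]
      with x h2 h3 h4 h5
    refine h2.trans ?_
    rw [Pi.add_apply, h3, Pi.smul_apply, h4, h5]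
    rfl
  · have h1 : (w + c • w') e = w e + c • w' e := rfl
    rw [h1]
    filter_upwards [Lp.coeFn_add (w e) (c • w' e), Lp.coeFn_smul c (w' e), hw e, hw' e]
      with x h2 h3 h4 h5
    refine h2.trans ?_
    rw [Pi.add_apply, h3, Pi.smul_apply, h4, h5]
    simp only [EdgewiseH2.addSMul, smul_eq_mul]
    ring

theorem SelfAdjointVertexConditions.inGraph_zero (W : Γ.SelfAdjointVertexConditions) :
    W.InGraph 0 0 := by
  refine ⟨EdgewiseH2.zero, W.holds_zero, fun e => ?_, fun e => ?_⟩
  · exact Lp.coeFn_zero ..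
  · refine (Lp.coeFn_zero ..).trans ?_
    filter_upwards with x
    simp [EdgewiseH2.zero]

/-- The graph of the Hamiltonian, as a subspace of `L²(Γ) × L²(Γ)`. -/
def SelfAdjointVertexConditions.graph (W : Γ.SelfAdjointVertexConditions) :
    Submodule ℂ (Γ.L2 × Γ.L2) where
  carrier := {p | W.InGraph p.1 p.2}
  zero_mem' := W.inGraph_zero
  add_mem' {p q} hp hq := by
    have h := W.inGraph_addSMul 1 hp hq
    rw [one_smul, one_smul] at h
    exact h
  smul_mem' c p hp := by
    have h := W.inGraph_addSMul c W.inGraph_zero hp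
    rw [zero_add, zero_add] at h
    exact h

theorem SelfAdjointVertexConditions.graph_single_valued (W : Γ.SelfAdjointVertexConditions)
    (p : Γ.L2 × Γ.L2) (hp : p ∈ W.graph) (h0 : p.1 = 0) : p.2 = 0 := by
  obtain ⟨f, -, hu, hw⟩ := hp
  apply lp.ext
  funext e
  refine Lp.ext ?_
  have h1 : f.toFun e =ᵐ[Γ.edgeMeasure e] 0 := by
    refine (hu e).symm.trans ?_
    rw [h0]
    exact Lp.coeFn_zero ..
  have h2 := second_deriv_ae_zero (Γ.len_pos e) (f.memLp_deriv₂ e) (f.toFun_eq e) (f.deriv₁_eq e) h1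
  refine (hw e).trans (Filter.EventuallyEq.trans ?_ (Lp.coeFn_zero ..).symm)
  filter_upwards [h2] with x hx
  simp [hx]

/-- The Hamiltonian `H = -d²/dx²` with the vertex conditions `W`, as an unbounded operator in
`L²(Γ)`. Its domain consists of the `u ∈ L²(Γ)` that are in `H²` on each edge, with `u'' ∈ L²(Γ)`,
and satisfy the vertex conditions. -/
def SelfAdjointVertexConditions.hamiltonian (W : Γ.SelfAdjointVertexConditions) :
    Γ.L2 →ₗ.[ℂ] Γ.L2 := W.graph.toLinearPMap

/-- The graph of the Hamiltonian is the intended one. -/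
theorem SelfAdjointVertexConditions.hamiltonian_graph (W : Γ.SelfAdjointVertexConditions) :
    W.hamiltonian.graph = W.graph :=
  Submodule.toLinearPMap_graph_eq _ W.graph_single_valued

end MetricGraph

/-- The resolvent set of an unbounded operator `T`: the set of all `z` such that `T - z` maps the
domain of `T` bijectively onto the whole space, with a bounded inverse `R`. -/
def resolventSetOf {X : Type*} [NormedAddCommGroup X] [NormedSpace ℂ X] (T : X →ₗ.[ℂ] X) :
    Set ℂ :=
  {z | ∃ R : X →L[ℂ] X,
    (∀ y, ∃ h : R y ∈ T.domain, T ⟨R y, h⟩ - z • R y = y) ∧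
    ∀ u : T.domain, R (T u - z • (u : X)) = u}

/-- The spectrum of an unbounded operator: the complement of the resolvent set. -/
def spectrumOf {X : Type*} [NormedAddCommGroup X] [NormedSpace ℂ X] (T : X →ₗ.[ℂ] X) : Set ℂ :=
  (resolventSetOf T)ᶜ

end QuantumGraphs

end

open MeasureTheory Set

namespace QuantumGraphs

/-! ### Primitives and solutions on one edge -/

/-! The bounded solution `φ` need not be square integrable, so it is damped: let `s` equal `exp (-ε
ρ(o, v))` at each vertex `v` and interpolate it on the edges by cubics whose derivative vanishes at
the vertices. At `v` the boundary data of `s φ` are those of `φ` times a scalar, so the vertex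
conditions survive. Sub-exponential growth puts `s φ` in `L²` (`SubexponentialGrowth.summable`).

Moreover `(H - lam)(s φ) = -(s'' φ + 2 s' φ')`. Along an edge `s` changes only by a factor at most
`1 + δ = exp (ε L)`, and `s'` is a multiple of `x (l - x)`. Caccioppoli's inequality with this very
weight bounds `s' φ'` by `φ` on the same edge, without boundary terms. Hence the error is at most a
constant times `δ ‖s φ‖`, edge by edge (`SolvesOn.integral_commutator_le`). As `δ` is arbitrary, `H
- lam` has no bounded inverse. -/

theorem hasDerivAt_of_primitive {l : ℝ} {f g : ℝ → ℂ} (hg : ContinuousOn g (Icc 0 l))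
    (hf : ∀ x ∈ Icc 0 l, f x = f 0 + ∫ t in (0 : ℝ)..x, g t) {x : ℝ} (hx : x ∈ Ioo 0 l) :
    HasDerivAt f (g x) x := by
  have hgx : ContinuousAt g x := hg.continuousAt (Icc_mem_nhds hx.1 hx.2)
  have hint : IntervalIntegrable g volume 0 x :=
    (hg.mono (by rw [uIcc_of_le hx.1.le]; exact Icc_subset_Icc_right hx.2.le)).intervalIntegrable
  have hmeas : StronglyMeasurableAtFilter g (nhds x) volume :=
    (hg.mono Ioo_subset_Icc_self).stronglyMeasurableAtFilter isOpen_Ioo x hx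
  have h := (intervalIntegral.integral_hasDerivAt_right hint hmeas hgx).const_add (f 0)
  refine h.congr_of_eventuallyEq ?_
  filter_upwards [Icc_mem_nhds hx.1 hx.2] with y hy
  exact hf y hy

/-- `f` and `g` are continuous on `[0, l]`, with `f' = g` and `g' = -lam f` in the interior. -/
structure SolvesOn (lam l : ℝ) (f g : ℝ → ℂ) : Prop where
  continuousOn_fst : ContinuousOn f (Icc 0 l)
  continuousOn_snd : ContinuousOn g (Icc 0 l)
  hasDerivAt_fst : ∀ x ∈ Ioo 0 l, HasDerivAt f (g x) x
  hasDerivAt_snd : ∀ x ∈ Ioo 0 l, HasDerivAt g (-((lam : ℂ) * f x)) x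

/-- Caccioppoli's inequality, with the cut-off function `x (l - x)`. -/
theorem SolvesOn.caccioppoli {lam l : ℝ} (hl : 0 < l) {f g : ℝ → ℂ} (h : SolvesOn lam l f g) :
    ∫ x in (0 : ℝ)..l, (x * (l - x)) ^ 2 * ‖g x‖ ^ 2 ≤
      (4 * l ^ 2 + 2 * |lam| * l ^ 4) * ∫ x in (0 : ℝ)..l, ‖f x‖ ^ 2 := by
  have hf := h.continuousOn_fst
  have hg := h.continuousOn_snd
  -- `D` is the derivative of `(x (l - x))² Re ⟨f, f'⟩`, which vanishes at both ends; hence its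
  -- integral is zero.
  set D : ℝ → ℝ := fun x => (2 * (x * (l - x)) * (l - 2 * x)) * inner ℝ (f x) (g x) +
    (x * (l - x)) ^ 2 * (‖g x‖ ^ 2 - lam * ‖f x‖ ^ 2) with hD
  have hDc : ContinuousOn D (Icc 0 l) := by
    have := hf.inner (𝕜 := ℝ) hg
    fun_prop
  have hD0 : ∫ x in (0 : ℝ)..l, D x = 0 := by
    have := intervalIntegral.integral_eq_sub_of_hasDerivAt_of_le (a := 0) (b := l)
      (f := fun x => (x * (l - x)) ^ 2 * inner ℝ (f x) (g x)) (f' := D) hl.le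
      (by have := hf.inner (𝕜 := ℝ) hg
          fun_prop)
      (fun x hx => by
        have h1 := (h.hasDerivAt_fst x hx).inner ℝ (h.hasDerivAt_snd x hx)
        have h2 : HasDerivAt (fun x : ℝ => (x * (l - x)) ^ 2)
            (2 * (x * (l - x)) * (l - 2 * x)) x := by
          have h3 := (((hasDerivAt_id x).mul ((hasDerivAt_id x).const_sub l))).pow 2
          refine h3.congr_deriv ?_
          simp only [Pi.mul_apply, id, Nat.cast_ofNat, Nat.add_one_sub_one, pow_one]
          ring
        refine (h2.mul h1).congr_deriv ?_
        have h4 : -((lam : ℂ) * f x) = (-lam) • f x := by simp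
        rw [h4, inner_smul_right, real_inner_self_eq_norm_sq, real_inner_self_eq_norm_sq]
        simp only [hD]
        ring)
      (hDc.intervalIntegrable_of_Icc hl.le)
    simpa using this
  -- `2 D` contains the left side twice. One copy absorbs the cross term `4 p q I` by Young's
  -- inequality, at the cost of `4 q² ‖f‖²`.
  have hpt : ∀ x ∈ Icc 0 l, (x * (l - x)) ^ 2 * ‖g x‖ ^ 2 ≤
      2 * D x + (4 * l ^ 2 + 2 * |lam| * l ^ 4) * ‖f x‖ ^ 2 := by
    intro x hx
    have hin := abs_real_inner_le_norm (f x) (g x)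
    have hp0 : 0 ≤ x * (l - x) := mul_nonneg hx.1 (by linarith [hx.2])
    have hp1 : x * (l - x) ≤ l ^ 2 := by nlinarith [hx.1, hx.2]
    have hq : (l - 2 * x) ^ 2 ≤ l ^ 2 := by nlinarith [hx.1, hx.2]
    have hpp : (x * (l - x)) ^ 2 ≤ l ^ 4 := by
      calc (x * (l - x)) ^ 2 ≤ (l ^ 2) ^ 2 := pow_le_pow_left₀ hp0 hp1 2
        _ = l ^ 4 := by ring
    simp only [hD]
    set p := x * (l - x)
    set q := l - 2 * x
    set I : ℝ := inner ℝ (f x) (g x)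
    set a := ‖f x‖
    set b := ‖g x‖
    have ha : 0 ≤ a := norm_nonneg _
    have hb : 0 ≤ b := norm_nonneg _
    have h1 : |p * q * I| ≤ p * |q| * (a * b) := by
      rw [abs_mul, abs_mul, abs_of_nonneg hp0]
      exact mul_le_mul_of_nonneg_left hin (by positivity)
    have h2 : 4 * (p * |q| * (a * b)) ≤ p ^ 2 * b ^ 2 + 4 * (q ^ 2 * a ^ 2) := by
      rw [← sq_abs q]
      nlinarith [sq_nonneg (p * b - 2 * (|q| * a))]
    have h3 : q ^ 2 * a ^ 2 ≤ l ^ 2 * a ^ 2 := by gcongr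
    have h4 : lam * (p ^ 2 * a ^ 2) ≤ |lam| * (l ^ 4 * a ^ 2) := by
      calc lam * (p ^ 2 * a ^ 2) ≤ |lam| * (p ^ 2 * a ^ 2) := by gcongr; exact le_abs_self _
        _ ≤ _ := by gcongr
    have h5 := (abs_le.mp h1).1
    nlinarith
  have hfi : IntervalIntegrable (fun x => ‖f x‖ ^ 2) volume 0 l :=
    ContinuousOn.intervalIntegrable_of_Icc hl.le (by fun_prop)
  have hDi : IntervalIntegrable D volume 0 l := hDc.intervalIntegrable_of_Icc hl.le
  calc ∫ x in (0 : ℝ)..l, (x * (l - x)) ^ 2 * ‖g x‖ ^ 2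
      ≤ ∫ x in (0 : ℝ)..l, (2 * D x + (4 * l ^ 2 + 2 * |lam| * l ^ 4) * ‖f x‖ ^ 2) :=
        intervalIntegral.integral_mono_on hl.le
          (ContinuousOn.intervalIntegrable_of_Icc hl.le (by fun_prop))
          ((hDi.const_mul 2).add (hfi.const_mul _)) hpt
    _ = _ := by
        rw [intervalIntegral.integral_add (hDi.const_mul 2) (hfi.const_mul _),
          intervalIntegral.integral_const_mul, intervalIntegral.integral_const_mul, hD0]
        ring

/-! ### The cut-off function on one edge -/

/-- The cubic which takes the values `c₀` at `0` and `c₁` at `l`, with zero derivative there. -/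
noncomputable def step (c₀ c₁ l x : ℝ) : ℝ :=
  c₀ + (c₁ - c₀) * ((3 * l * x ^ 2 - 2 * x ^ 3) / l ^ 3)

/-- The first derivative of `step`. -/
noncomputable def stepDeriv (c₀ c₁ l x : ℝ) : ℝ := (c₁ - c₀) * 6 / l ^ 3 * (x * (l - x))

/-- The second derivative of `step`. -/
noncomputable def stepDeriv₂ (c₀ c₁ l x : ℝ) : ℝ := (c₁ - c₀) * 6 / l ^ 3 * (l - 2 * x)

section step

variable {c₀ c₁ l : ℝ}

theorem step_zero : step c₀ c₁ l 0 = c₀ := by simp [step]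

theorem step_len (hl : 0 < l) : step c₀ c₁ l l = c₁ := by
  unfold step
  field_simp
  ring

theorem stepDeriv_zero : stepDeriv c₀ c₁ l 0 = 0 := by simp [stepDeriv]

theorem stepDeriv_len : stepDeriv c₀ c₁ l l = 0 := by simp [stepDeriv]

theorem hasDerivAt_step (x : ℝ) : HasDerivAt (step c₀ c₁ l) (stepDeriv c₀ c₁ l x) x := by
  have h := (((((hasDerivAt_id x).pow 2).const_mul (3 * l)).sub
    (((hasDerivAt_id x).pow 3).const_mul 2)).div_const (l ^ 3)).const_mul (c₁ - c₀)
  refine (h.const_add c₀).congr_deriv ?_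
  simp [stepDeriv]
  ring

theorem hasDerivAt_stepDeriv (x : ℝ) :
    HasDerivAt (stepDeriv c₀ c₁ l) (stepDeriv₂ c₀ c₁ l x) x := by
  have h := (((hasDerivAt_id x).mul ((hasDerivAt_id x).const_sub l))).const_mul
    ((c₁ - c₀) * 6 / l ^ 3)
  refine h.congr_deriv ?_
  simp only [stepDeriv₂, id]
  ring

theorem continuous_step : Continuous (step c₀ c₁ l) := by unfold step; fun_prop

theorem continuous_stepDeriv : Continuous (stepDeriv c₀ c₁ l) := by unfold stepDeriv; fun_prop

theorem continuous_stepDeriv₂ : Continuous (stepDeriv₂ c₀ c₁ l) := by unfold stepDeriv₂; fun_prop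

/-- With `y = x / l`, the weight `3 y² - 2 y³` lies in `[0, 1]`, so the value is a convex
combination of `c₀` and `c₁`. -/
theorem step_mem (hl : 0 < l) {x : ℝ} (hx : x ∈ Icc 0 l) :
    step c₀ c₁ l x ∈ Icc (min c₀ c₁) (max c₀ c₁) := by
  have h0 : 0 ≤ (3 * l * x ^ 2 - 2 * x ^ 3) / l ^ 3 := by
    apply div_nonneg _ (by positivity)
    nlinarith [mul_nonneg (sq_nonneg x) (sub_nonneg.2 hx.2), mul_nonneg (sq_nonneg x) hl.le]
  have h1 : (3 * l * x ^ 2 - 2 * x ^ 3) / l ^ 3 ≤ 1 := by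
    rw [div_le_one (by positivity)]
    nlinarith [mul_nonneg (sq_nonneg (l - x)) hl.le, mul_nonneg (sq_nonneg (l - x)) hx.1]
  unfold step
  set t := (3 * l * x ^ 2 - 2 * x ^ 3) / l ^ 3
  have e : c₀ + (c₁ - c₀) * t = (1 - t) * c₀ + t * c₁ := by ring
  rw [e]
  constructor
  · nlinarith [mul_le_mul_of_nonneg_left (min_le_left c₀ c₁) (sub_nonneg.2 h1),
      mul_le_mul_of_nonneg_left (min_le_right c₀ c₁) h0]
  · nlinarith [mul_le_mul_of_nonneg_left (le_max_left c₀ c₁) (sub_nonneg.2 h1),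
      mul_le_mul_of_nonneg_left (le_max_right c₀ c₁) h0]

end step

/-- The commutator of `d²/dx²` and the multiplication by `step` is small if `c₀` and `c₁` are close
to each other. -/
theorem SolvesOn.integral_commutator_le {lam l l₀ c₀ c₁ δ : ℝ} (hl₀ : 0 < l₀) (hl : l₀ ≤ l)
    (hc₀ : 0 < c₀) (hc₁ : 0 < c₁) (hδ : |c₁ - c₀| ≤ δ * min c₀ c₁)
    {f g : ℝ → ℂ} (h : SolvesOn lam l f g) :
    ∫ x in (0 : ℝ)..l, ‖(stepDeriv₂ c₀ c₁ l x : ℂ) * f x + 2 * (stepDeriv c₀ c₁ l x * g x)‖ ^ 2 ≤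
      (1224 / l₀ ^ 4 + 576 * |lam| / l₀ ^ 2) * δ ^ 2 *
        ∫ x in (0 : ℝ)..l, ‖(step c₀ c₁ l x : ℂ) * f x‖ ^ 2 := by
  have hl' : 0 < l := hl₀.trans_le hl
  have hf := h.continuousOn_fst
  have hg := h.continuousOn_snd
  have hs := continuous_step (c₀ := c₀) (c₁ := c₁) (l := l)
  have hs1 := continuous_stepDeriv (c₀ := c₀) (c₁ := c₁) (l := l)
  have hs2 := continuous_stepDeriv₂ (c₀ := c₀) (c₁ := c₁) (l := l)
  have hm : 0 < min c₀ c₁ := lt_min hc₀ hc₁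
  set m := min c₀ c₁
  set A := (c₁ - c₀) * 6 / l ^ 3 with hA
  have hfi : IntervalIntegrable (fun x => ‖f x‖ ^ 2) volume 0 l :=
    ContinuousOn.intervalIntegrable_of_Icc hl'.le (by fun_prop)
  have hgi : IntervalIntegrable (fun x => (x * (l - x)) ^ 2 * ‖g x‖ ^ 2) volume 0 l :=
    ContinuousOn.intervalIntegrable_of_Icc hl'.le (by fun_prop)
  have hI : 0 ≤ ∫ x in (0 : ℝ)..l, ‖f x‖ ^ 2 :=
    intervalIntegral.integral_nonneg hl'.le fun x _ => by positivity
  -- Use `‖a + b‖² ≤ 2 ‖a‖² + 2 ‖b‖²`, with `s' = A x (l - x)` and `|s''| ≤ |A| l`.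
  have h1 : ∫ x in (0 : ℝ)..l,
      ‖(stepDeriv₂ c₀ c₁ l x : ℂ) * f x + 2 * (stepDeriv c₀ c₁ l x * g x)‖ ^ 2 ≤
      ∫ x in (0 : ℝ)..l, (2 * A ^ 2 * l ^ 2 * ‖f x‖ ^ 2 +
        8 * A ^ 2 * ((x * (l - x)) ^ 2 * ‖g x‖ ^ 2)) := by
    refine intervalIntegral.integral_mono_on hl'.le
      (ContinuousOn.intervalIntegrable_of_Icc hl'.le (by fun_prop))
      ((hfi.const_mul _).add (hgi.const_mul _)) fun x hx => ?_
    have hq : (l - 2 * x) ^ 2 ≤ l ^ 2 := by nlinarith [hx.1, hx.2]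
    have n1 : ‖(stepDeriv₂ c₀ c₁ l x : ℂ) * f x‖ ^ 2 ≤ A ^ 2 * l ^ 2 * ‖f x‖ ^ 2 := by
      rw [norm_mul, mul_pow, Complex.norm_real, Real.norm_eq_abs, sq_abs, stepDeriv₂, ← hA, mul_pow]
      gcongr
    have n2 : ‖2 * ((stepDeriv c₀ c₁ l x : ℂ) * g x)‖ ^ 2 =
        4 * A ^ 2 * ((x * (l - x)) ^ 2 * ‖g x‖ ^ 2) := by
      rw [norm_mul, norm_mul, mul_pow, mul_pow, Complex.norm_real, Real.norm_eq_abs, sq_abs,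
        stepDeriv, ← hA, Complex.norm_two]
      ring
    have n3 := norm_add_le ((stepDeriv₂ c₀ c₁ l x : ℂ) * f x) (2 * ((stepDeriv c₀ c₁ l x : ℂ) * g x))
    have n4 := pow_le_pow_left₀ (norm_nonneg _) n3 2
    nlinarith [sq_nonneg (‖(stepDeriv₂ c₀ c₁ l x : ℂ) * f x‖ -
      ‖2 * ((stepDeriv c₀ c₁ l x : ℂ) * g x)‖)]
  rw [intervalIntegral.integral_add (hfi.const_mul _) (hgi.const_mul _),
    intervalIntegral.integral_const_mul, intervalIntegral.integral_const_mul] at h1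
  have h2 := h.caccioppoli hl'
  have h3 : m ^ 2 * ∫ x in (0 : ℝ)..l, ‖f x‖ ^ 2 ≤
      ∫ x in (0 : ℝ)..l, ‖(step c₀ c₁ l x : ℂ) * f x‖ ^ 2 := by
    rw [← intervalIntegral.integral_const_mul]
    refine intervalIntegral.integral_mono_on hl'.le (hfi.const_mul _)
      (ContinuousOn.intervalIntegrable_of_Icc hl'.le (by fun_prop)) fun x hx => ?_
    rw [norm_mul, mul_pow, Complex.norm_real, Real.norm_eq_abs, sq_abs]
    have := (step_mem (c₀ := c₀) (c₁ := c₁) hl' hx).1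
    gcongr
  have hA2 : A ^ 2 ≤ δ ^ 2 * m ^ 2 * (36 / l ^ 6) := by
    have : (c₁ - c₀) ^ 2 ≤ (δ * m) ^ 2 := by
      rw [← sq_abs (c₁ - c₀)]; exact pow_le_pow_left₀ (abs_nonneg _) hδ 2
    calc A ^ 2 = (c₁ - c₀) ^ 2 * (36 / l ^ 6) := by rw [hA]; field_simp; norm_num
      _ ≤ (δ * m) ^ 2 * (36 / l ^ 6) := by gcongr
      _ = _ := by ring
  set I := ∫ x in (0 : ℝ)..l, ‖f x‖ ^ 2
  calc _ ≤ 2 * A ^ 2 * l ^ 2 * I + 8 * A ^ 2 * ((4 * l ^ 2 + 2 * |lam| * l ^ 4) * I) := by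
        refine h1.trans ?_
        gcongr
    -- Here `34 = 2 + 8 · 4` and `16 = 8 · 2`; the factor `36` from `A²` then gives `1224` and
    -- `576`.
    _ = A ^ 2 * ((34 * l ^ 2 + 16 * |lam| * l ^ 4) * I) := by ring
    _ ≤ δ ^ 2 * m ^ 2 * (36 / l ^ 6) * ((34 * l ^ 2 + 16 * |lam| * l ^ 4) * I) := by gcongr
    _ = (1224 / l ^ 4 + 576 * |lam| / l ^ 2) * δ ^ 2 * (m ^ 2 * I) := by
        field_simp
        ring
    _ ≤ (1224 / l₀ ^ 4 + 576 * |lam| / l₀ ^ 2) * δ ^ 2 * (m ^ 2 * I) := by gcongr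
    _ ≤ _ := by gcongr

/-! ### Square-integrable functions on one edge -/

theorem norm_toLp_sq {l : ℝ} (hl : 0 ≤ l) {f : ℝ → ℂ}
    (h : MemLp f 2 (volume.restrict (Icc 0 l))) :
    ‖h.toLp f‖ ^ 2 = ∫ x in (0 : ℝ)..l, ‖f x‖ ^ 2 := by
  rw [← real_inner_self_eq_norm_sq, L2.inner_def, intervalIntegral.integral_of_le hl,
    ← integral_Icc_eq_integral_Ioc]
  refine integral_congr_ae ?_
  filter_upwards [h.coeFn_toLp] with x hx
  rw [hx, real_inner_self_eq_norm_sq]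

theorem memLp_of_continuousOn_Icc {l : ℝ} {f : ℝ → ℂ} (hf : ContinuousOn f (Icc 0 l)) :
    MemLp f 2 (volume.restrict (Icc 0 l)) := by
  rw [memLp_two_iff_integrable_sq_norm (hf.aestronglyMeasurable measurableSet_Icc)]
  exact (hf.norm.pow 2).integrableOn_Icc

namespace MetricGraph

variable {V E : Type*} {Γ : MetricGraph V E}

theorem EdgewiseH2.continuousOn_deriv₁ (f : Γ.EdgewiseH2) (e : E) :
    ContinuousOn (f.deriv₁ e) (Γ.segment e) :=
  continuousOn_of_primitive (f.integrableOn_deriv₂ e) (f.deriv₁_eq e)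

theorem EdgewiseH2.continuousOn_toFun (f : Γ.EdgewiseH2) (e : E) :
    ContinuousOn (f.toFun e) (Γ.segment e) :=
  continuousOn_of_primitive (f.integrableOn_deriv₁ e) (f.toFun_eq e)

/-- The second derivative is given only almost everywhere, but the equation lets the continuous
function `-lam f` replace it under the integral, so `f` is a classical solution inside the edge. -/
theorem EdgewiseH2.IsSolution.solvesOn {f : Γ.EdgewiseH2} {lam : ℝ} (hf : f.IsSolution lam)
    (e : E) : SolvesOn lam (Γ.len e) (f.toFun e) (f.deriv₁ e) where
  continuousOn_fst := f.continuousOn_toFun e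
  continuousOn_snd := f.continuousOn_deriv₁ e
  hasDerivAt_fst x hx := hasDerivAt_of_primitive (f.continuousOn_deriv₁ e) (f.toFun_eq e) hx
  hasDerivAt_snd x hx := by
    have hc := f.continuousOn_toFun e
    refine hasDerivAt_of_primitive (g := fun x => -((lam : ℂ) * f.toFun e x)) (by fun_prop)
      (fun y hy => ?_) hx
    rw [f.deriv₁_eq e y hy]
    congr 1
    refine intervalIntegral.integral_congr_ae ?_
    have h := (ae_restrict_iff' measurableSet_Icc).1 (hf e)
    filter_upwards [h] with t ht hty
    rw [uIoc_of_le hy.1] at hty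
    rw [← ht ⟨hty.1.le, hty.2.trans hy.2⟩, neg_neg]

/-! ### Cutting off a solution -/

section cutoff

variable {f : Γ.EdgewiseH2} {lam : ℝ}

/-- The product of a solution and of the function that is equal to `c v` at the vertices `v`, with
vanishing derivatives there, and interpolates by cubic polynomials on the edges. -/
noncomputable def EdgewiseH2.IsSolution.cutoff (hf : f.IsSolution lam) (c : V → ℝ) :
    Γ.EdgewiseH2 where
  toFun e x := step (c (Γ.endpt e false)) (c (Γ.endpt e true)) (Γ.len e) x * f.toFun e x
  deriv₁ e x := stepDeriv (c (Γ.endpt e false)) (c (Γ.endpt e true)) (Γ.len e) x * f.toFun e x +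
    step (c (Γ.endpt e false)) (c (Γ.endpt e true)) (Γ.len e) x * f.deriv₁ e x
  -- The equation has been used to replace `s f''` by `-lam s f`. This leaves the commutator in
  -- brackets and makes the expression continuous.
  deriv₂ e x := (stepDeriv₂ (c (Γ.endpt e false)) (c (Γ.endpt e true)) (Γ.len e) x * f.toFun e x +
    2 * (stepDeriv (c (Γ.endpt e false)) (c (Γ.endpt e true)) (Γ.len e) x * f.deriv₁ e x)) -
    lam * (step (c (Γ.endpt e false)) (c (Γ.endpt e true)) (Γ.len e) x * f.toFun e x)
  memLp_deriv₂ e := by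
    have h0 := f.continuousOn_toFun e
    have h1 := f.continuousOn_deriv₁ e
    have hs := continuous_step (c₀ := c (Γ.endpt e false)) (c₁ := c (Γ.endpt e true)) (l := Γ.len e)
    have hs1 :=
      continuous_stepDeriv (c₀ := c (Γ.endpt e false)) (c₁ := c (Γ.endpt e true)) (l := Γ.len e)
    have hs2 :=
      continuous_stepDeriv₂ (c₀ := c (Γ.endpt e false)) (c₁ := c (Γ.endpt e true)) (l := Γ.len e)
    exact memLp_of_continuousOn_Icc (by fun_prop)
  toFun_eq e x hx := by
    have h0 := (f.continuousOn_toFun e).mono (Icc_subset_Icc_right hx.2)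
    have h1 := (f.continuousOn_deriv₁ e).mono (Icc_subset_Icc_right hx.2)
    have hs := continuous_step (c₀ := c (Γ.endpt e false)) (c₁ := c (Γ.endpt e true)) (l := Γ.len e)
    have hs1 :=
      continuous_stepDeriv (c₀ := c (Γ.endpt e false)) (c₁ := c (Γ.endpt e true)) (l := Γ.len e)
    rw [intervalIntegral.integral_eq_sub_of_hasDerivAt_of_le hx.1 (by fun_prop)
      (fun y hy => (hasDerivAt_step y).ofReal_comp.mul
        ((hf.solvesOn e).hasDerivAt_fst y ⟨hy.1, hy.2.trans_le hx.2⟩))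
      (ContinuousOn.intervalIntegrable_of_Icc hx.1 (by fun_prop))]
    simp
  deriv₁_eq e x hx := by
    have h0 := (f.continuousOn_toFun e).mono (Icc_subset_Icc_right hx.2)
    have h1 := (f.continuousOn_deriv₁ e).mono (Icc_subset_Icc_right hx.2)
    have hs := continuous_step (c₀ := c (Γ.endpt e false)) (c₁ := c (Γ.endpt e true)) (l := Γ.len e)
    have hs1 :=
      continuous_stepDeriv (c₀ := c (Γ.endpt e false)) (c₁ := c (Γ.endpt e true)) (l := Γ.len e)
    have hs2 :=
      continuous_stepDeriv₂ (c₀ := c (Γ.endpt e false)) (c₁ := c (Γ.endpt e true)) (l := Γ.len e)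
    have hd : ∀ y ∈ Ioo 0 x, HasDerivAt _ _ y := fun y hy =>
      ((hasDerivAt_stepDeriv (c₀ := c (Γ.endpt e false)) (c₁ := c (Γ.endpt e true))
        (l := Γ.len e) y).ofReal_comp.mul
        ((hf.solvesOn e).hasDerivAt_fst y ⟨hy.1, hy.2.trans_le hx.2⟩)).add
      ((hasDerivAt_step (c₀ := c (Γ.endpt e false)) (c₁ := c (Γ.endpt e true))
        (l := Γ.len e) y).ofReal_comp.mul
        ((hf.solvesOn e).hasDerivAt_snd y ⟨hy.1, hy.2.trans_le hx.2⟩))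
    rw [intervalIntegral.integral_eq_sub_of_hasDerivAt_of_le hx.1 (f := fun y =>
      stepDeriv (c (Γ.endpt e false)) (c (Γ.endpt e true)) (Γ.len e) y * f.toFun e y +
      step (c (Γ.endpt e false)) (c (Γ.endpt e true)) (Γ.len e) y * f.deriv₁ e y) (by fun_prop)
      (fun y hy => (hd y hy).congr_deriv (by ring))
      (ContinuousOn.intervalIntegrable_of_Icc hx.1 (by fun_prop))]
    simp

/-- Since `s' = 0` at the ends of the edges, values and outgoing derivatives at `v` are both
multiplied by `c v`, and `W_v` is a linear subspace. -/
theorem EdgewiseH2.IsSolution.holds_cutoff {W : Γ.SelfAdjointVertexConditions}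
    (hf : f.IsSolution lam) (hW : W.Holds f) (c : V → ℝ) : W.Holds (hf.cutoff c) := by
  intro v
  convert (W.space v).smul_mem (c v : ℂ) (hW v) using 1
  ext ⟨⟨e, b⟩, rfl⟩
  · cases b <;>
      simp [EdgewiseH2.valueAt, cutoff, step_zero, step_len (Γ.len_pos e)]
  · cases b <;>
      simp [EdgewiseH2.outDerivAt, cutoff, step_zero, step_len (Γ.len_pos e), stepDeriv_zero,
        stepDeriv_len]

end cutoff

/-! ### The distance of a vertex to the root -/

theorem IsWalk.nonneg {u v : V} {s : ℝ} (h : Γ.IsWalk u v s) : 0 ≤ s := by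
  induction h with
  | nil => exact le_rfl
  | snoc e b s _ ih => exact add_nonneg ih (Γ.len_pos e).le

variable (Γ) in
theorem exists_isWalk (u v : V) : ∃ s, Γ.IsWalk u v s := by
  induction Γ.connected u v with
  | refl => exact ⟨0, .nil⟩
  | tail _ h ih =>
    obtain ⟨s, hs⟩ := ih
    obtain ⟨e, b, rfl, rfl⟩ := h
    exact ⟨_, hs.snoc e b s⟩

variable (Γ) in
/-- The length of the shortest walk from the vertex `o` to the vertex `v`. -/
noncomputable def vertexDist (o v : V) : ℝ := sInf {s | Γ.IsWalk o v s}

theorem bddBelow_isWalk (o v : V) : BddBelow {s | Γ.IsWalk o v s} := ⟨0, fun _ h => h.nonneg⟩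

theorem vertexDist_nonneg (o v : V) : 0 ≤ Γ.vertexDist o v :=
  Real.sInf_nonneg fun _ h => h.nonneg

theorem vertexDist_endpt_le (o : V) (e : E) (b : Bool) :
    Γ.vertexDist o (Γ.endpt e (!b)) ≤ Γ.vertexDist o (Γ.endpt e b) + Γ.len e := by
  rw [← sub_le_iff_le_add]
  refine le_csInf (Γ.exists_isWalk _ _) fun s hs => ?_
  rw [sub_le_iff_le_add]
  exact csInf_le (bddBelow_isWalk _ _) (IsWalk.snoc e b s hs)

theorem abs_vertexDist_sub_le (o : V) (e : E) :
    |Γ.vertexDist o (Γ.endpt e true) - Γ.vertexDist o (Γ.endpt e false)| ≤ Γ.len e := by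
  have h1 := Γ.vertexDist_endpt_le o e true
  have h2 := Γ.vertexDist_endpt_le o e false
  simp only [Bool.not_true, Bool.not_false] at h1 h2
  rw [abs_le]
  constructor <;> linarith

theorem rho_le (o : V) (e : E) {x : ℝ} (hx : x ∈ Γ.segment e) :
    Γ.rho o e x ≤ Γ.vertexDist o (Γ.endpt e false) + x := by
  rw [← sub_le_iff_le_add]
  refine le_csInf (Γ.exists_isWalk _ _) fun s hs => ?_
  rw [sub_le_iff_le_add]
  refine csInf_le ⟨0, ?_⟩ ⟨false, s, hs, by simp [distToEnd]⟩
  rintro _ ⟨b, t, ht, rfl⟩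
  refine add_nonneg ht.nonneg ?_
  unfold distToEnd
  split_ifs
  · linarith [hx.2]
  · exact hx.1

theorem ballOn_eq_segment {o : V} {r : ℝ} {e : E}
    (h : Γ.vertexDist o (Γ.endpt e false) + Γ.len e ≤ r) : Γ.ballOn o r e = Γ.segment e := by
  ext x
  refine ⟨fun hx => hx.1, fun hx => ⟨hx, (rho_le o e hx).trans ?_⟩⟩
  linarith [hx.2]

-- An edge that starts within distance `r` of the root lies entirely in the ball of radius `r + L`.
open Classical in
theorem tsum_len_le_ballVolume {L : ℝ} (hL : ∀ e, Γ.len e ≤ L) (o : V) (r : ℝ) :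
    ∑' e, (if Γ.vertexDist o (Γ.endpt e false) ≤ r then ENNReal.ofReal (Γ.len e) else 0) ≤
      Γ.ballVolume o (r + L) := by
  refine ENNReal.tsum_le_tsum fun e => ?_
  split_ifs with h
  · rw [ballOn_eq_segment (by linarith [hL e]), Real.volume_Icc, sub_zero]
  · exact zero_le

/-- Under sub-exponential growth, exponentially decaying functions are integrable. -/
theorem SubexponentialGrowth.summable {o : V} (h : Γ.SubexponentialGrowth o) {L : ℝ} (hL0 : 0 ≤ L)
    (hL : ∀ e, Γ.len e ≤ L) {ε : ℝ} (hε : 0 < ε) :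
    Summable fun e => Real.exp (-(2 * ε * Γ.vertexDist o (Γ.endpt e false))) * Γ.len e := by
  classical
  obtain ⟨C, hC⟩ := h ε hε
  set d : E → ℝ := fun e => Γ.vertexDist o (Γ.endpt e false)
  have hsum : Summable fun n : ℕ => C * Real.exp (ε * (1 + L)) * Real.exp (-ε) ^ n :=
    (summable_geometric_of_lt_one (Real.exp_pos _).le (by simpa using hε)).mul_left _
  have hle : ∑' e, ENNReal.ofReal (Real.exp (-(2 * ε * d e)) * Γ.len e) ≤
      ∑' n : ℕ, ENNReal.ofReal (C * Real.exp (ε * (1 + L)) * Real.exp (-ε) ^ n) := by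
    calc ∑' e, ENNReal.ofReal (Real.exp (-(2 * ε * d e)) * Γ.len e)
        ≤ ∑' e, ∑' n : ℕ, ENNReal.ofReal (Real.exp (-(2 * ε * n))) *
          (if d e ≤ n + 1 then ENNReal.ofReal (Γ.len e) else 0) := by
          refine ENNReal.tsum_le_tsum fun e => ?_
          -- The single term `n = ⌊d e⌋` already dominates.
          refine le_trans ?_ (ENNReal.le_tsum ⌊d e⌋₊)
          rw [if_pos (Nat.lt_floor_add_one _).le, ENNReal.ofReal_mul (Real.exp_pos _).le]
          have : (⌊d e⌋₊ : ℝ) ≤ d e := Nat.floor_le (Γ.vertexDist_nonneg o (Γ.endpt e false))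
          gcongr
      _ = ∑' n : ℕ, ENNReal.ofReal (Real.exp (-(2 * ε * n))) *
          ∑' e, (if d e ≤ n + 1 then ENNReal.ofReal (Γ.len e) else 0) := by
          rw [ENNReal.tsum_comm]
          simp_rw [ENNReal.tsum_mul_left]
      _ ≤ _ := by
          refine ENNReal.tsum_le_tsum fun n => ?_
          -- Growth at rate `ε` against decay at rate `2 ε` leaves the geometric factor `exp (-ε
          -- n)`.
          calc _ ≤ ENNReal.ofReal (Real.exp (-(2 * ε * n))) *
              ENNReal.ofReal (C * Real.exp (ε * (n + 1 + L))) := by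
                gcongr
                exact (tsum_len_le_ballVolume hL o _).trans (hC _ (by positivity))
            _ = _ := by
                rw [← ENNReal.ofReal_mul (Real.exp_pos _).le, ← Real.exp_nat_mul]
                congr 1
                rw [mul_left_comm, ← Real.exp_add, mul_assoc C, ← Real.exp_add]
                congr 2
                ring
  have hfin := ne_top_of_le_ne_top hsum.tsum_ofReal_ne_top hle
  refine (ENNReal.summable_toReal hfin).congr fun e => ?_
  exact ENNReal.toReal_ofReal (mul_nonneg (Real.exp_pos _).le (Γ.len_pos e).le)

end MetricGraph

/-- The oscillation is measured relative to the smaller value, so that the commutator can be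
compared with the damped function itself on the same edge. -/
theorem abs_exp_neg_sub_le {a b ε L : ℝ} (hε : 0 ≤ ε) (h : |b - a| ≤ L) :
    |Real.exp (-(ε * b)) - Real.exp (-(ε * a))| ≤
      (Real.exp (ε * L) - 1) * min (Real.exp (-(ε * a))) (Real.exp (-(ε * b))) := by
  wlog hab : a ≤ b generalizing a b
  · rw [abs_sub_comm, min_comm]
    exact this (by rwa [abs_sub_comm]) (le_of_not_ge hab)
  have h1 : Real.exp (-(ε * b)) ≤ Real.exp (-(ε * a)) := by gcongr
  rw [min_eq_right h1, abs_sub_comm, abs_of_nonneg (sub_nonneg.2 h1), sub_mul, one_mul,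
    ← Real.exp_add]
  gcongr
  nlinarith [(abs_le.1 h).2]

namespace MetricGraph

variable {V E : Type*} {Γ : MetricGraph V E}

/-! ### Resolvent bound and approximate eigenvectors -/

theorem SelfAdjointVertexConditions.norm_le_of_mem_resolventSetOf
    {W : Γ.SelfAdjointVertexConditions} {z : ℂ} (hz : z ∈ resolventSetOf W.hamiltonian) :
    ∃ C : ℝ, 0 ≤ C ∧ ∀ u w : Γ.L2, W.InGraph u (w + z • u) → ‖u‖ ≤ C * ‖w‖ := by
  obtain ⟨R, -, hR⟩ := hz
  refine ⟨‖R‖, norm_nonneg _, fun u w h => ?_⟩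
  have hg : (u, w + z • u) ∈ W.hamiltonian.graph := by
    rw [W.hamiltonian_graph]
    exact h
  obtain ⟨y, rfl, hy⟩ := (LinearPMap.mem_graph_iff _).1 hg
  have h1 := hR y
  simp only at hy
  rw [hy, add_sub_cancel_right] at h1
  rw [← h1]
  exact R.le_opNorm w

/-- Approximate eigenvectors, obtained by damping a bounded generalized eigenfunction. -/
theorem EdgewiseH2.IsSolution.exists_approximate_eigenvector {o : V} {lam l₀ L M : ℝ}
    {W : Γ.SelfAdjointVertexConditions} {f : Γ.EdgewiseH2} (hf : f.IsSolution lam)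
    (hl₀ : 0 < l₀) (hL0 : 0 < L) (hl : ∀ e, l₀ ≤ Γ.len e) (hL : ∀ e, Γ.len e ≤ L)
    (hgrowth : Γ.SubexponentialGrowth o) (hW : W.Holds f)
    (hM : ∀ e, ∀ x ∈ Γ.segment e, ‖f.toFun e x‖ ≤ M) (hne : f.IsNonzero) {δ : ℝ} (hδ : 0 < δ) :
    ∃ u w : Γ.L2, W.InGraph u (w + (lam : ℂ) • u) ∧ u ≠ 0 ∧
      ‖w‖ ≤ √(1224 / l₀ ^ 4 + 576 * |lam| / l₀ ^ 2) * δ * ‖u‖ := by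
  set K := 1224 / l₀ ^ 4 + 576 * |lam| / l₀ ^ 2 with hK
  -- Chosen so that `exp (ε L) - 1 = δ`.
  set ε := Real.log (1 + δ) / L with hε
  have hεpos : 0 < ε := div_pos (Real.log_pos (by linarith)) hL0
  have hεL : Real.exp (ε * L) = 1 + δ := by
    rw [hε, div_mul_cancel₀ _ hL0.ne', Real.exp_log (by linarith)]
  set c : V → ℝ := fun v => Real.exp (-(ε * Γ.vertexDist o v)) with hc
  have hcδ : ∀ e, |c (Γ.endpt e true) - c (Γ.endpt e false)| ≤
      δ * min (c (Γ.endpt e false)) (c (Γ.endpt e true)) := fun e => by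
    have := abs_exp_neg_sub_le hεpos.le ((Γ.abs_vertexDist_sub_le o e).trans (hL e))
    rwa [hεL, add_sub_cancel_left] at this
  have hcpos : ∀ v, 0 < c v := fun v => Real.exp_pos _
  set g := hf.cutoff c with hg
  have hgLp : ∀ e, MemLp (g.toFun e) 2 (Γ.edgeMeasure e) := fun e =>
    memLp_of_continuousOn_Icc (g.continuousOn_toFun e)
  have hcomp : ∀ e, ContinuousOn (fun x =>
      (stepDeriv₂ (c (Γ.endpt e false)) (c (Γ.endpt e true)) (Γ.len e) x : ℂ) * f.toFun e x +
      2 * (stepDeriv (c (Γ.endpt e false)) (c (Γ.endpt e true)) (Γ.len e) x * f.deriv₁ e x))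
      (Γ.segment e) := fun e => by
    have h0 := f.continuousOn_toFun e
    have h1 := f.continuousOn_deriv₁ e
    have hs1 :=
      continuous_stepDeriv (c₀ := c (Γ.endpt e false)) (c₁ := c (Γ.endpt e true)) (l := Γ.len e)
    have hs2 :=
      continuous_stepDeriv₂ (c₀ := c (Γ.endpt e false)) (c₁ := c (Γ.endpt e true)) (l := Γ.len e)
    fun_prop
  have hwLp := fun e => memLp_of_continuousOn_Icc (hcomp e)
  set u₀ : ∀ e, Lp ℂ 2 (Γ.edgeMeasure e) := fun e => (hgLp e).toLp with hu₀
  set w₀ : ∀ e, Lp ℂ 2 (Γ.edgeMeasure e) := fun e => -(hwLp e).toLp with hw₀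
  -- The damping factor on the whole edge is controlled by its value at the end `false`, the only
  -- end that enters the summability statement.
  have hmax : ∀ e, max (c (Γ.endpt e false)) (c (Γ.endpt e true)) ≤
      (1 + δ) * c (Γ.endpt e false) := fun e => by
    have h1 := (abs_le.1 (hcδ e)).2
    have h2 := mul_le_mul_of_nonneg_left
      (min_le_left (c (Γ.endpt e false)) (c (Γ.endpt e true))) hδ.le
    exact max_le (by nlinarith [hcpos (Γ.endpt e false)]) (by linarith)
  have hu_sq : ∀ e, ‖u₀ e‖ ^ 2 ≤ ((1 + δ) * M) ^ 2 *
      (Real.exp (-(2 * ε * Γ.vertexDist o (Γ.endpt e false))) * Γ.len e) := fun e => by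
    have hpt : ∀ x ∈ Icc 0 (Γ.len e),
        ‖g.toFun e x‖ ^ 2 ≤ ((1 + δ) * c (Γ.endpt e false) * M) ^ 2 := fun x hx => by
      have h1 := step_mem (c₀ := c (Γ.endpt e false)) (c₁ := c (Γ.endpt e true)) (Γ.len_pos e) hx
      have h2 : 0 ≤ step (c (Γ.endpt e false)) (c (Γ.endpt e true)) (Γ.len e) x :=
        (lt_min (hcpos _) (hcpos _)).le.trans h1.1
      refine pow_le_pow_left₀ (norm_nonneg _) ?_ 2
      simp only [hg, cutoff]
      rw [norm_mul, Complex.norm_real, Real.norm_eq_abs, abs_of_nonneg h2]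
      exact mul_le_mul (h1.2.trans (hmax e)) (hM e x hx) (norm_nonneg _)
        (mul_nonneg (by linarith) (hcpos _).le)
    rw [hu₀, norm_toLp_sq (Γ.len_pos e).le]
    refine (intervalIntegral.integral_mono_on (Γ.len_pos e).le
      (ContinuousOn.intervalIntegrable_of_Icc (Γ.len_pos e).le
        ((g.continuousOn_toFun e).norm.pow 2)) intervalIntegrable_const hpt).trans_eq ?_
    have h3 : c (Γ.endpt e false) ^ 2 =
        Real.exp (-(2 * ε * Γ.vertexDist o (Γ.endpt e false))) := by
      rw [hc, ← Real.exp_nat_mul]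
      congr 1
      push_cast
      ring
    rw [intervalIntegral.integral_const, smul_eq_mul, ← h3]
    ring
  have hu_mem : Memℓp u₀ 2 := by
    refine memℓp_gen ?_
    simp only [ENNReal.toReal_ofNat, Real.rpow_ofNat]
    exact ((hgrowth.summable hL0.le hL hεpos).mul_left _).of_nonneg_of_le
      (fun e => sq_nonneg _) hu_sq
  -- This edgewise bound gives both that `w₀` lies in the Hilbert sum and the final norm estimate.
  have hw_le : ∀ e, ‖w₀ e‖ ≤ √K * δ * ‖u₀ e‖ := fun e => by
    have h1 := (hf.solvesOn e).integral_commutator_le hl₀ (hl e) (hcpos _) (hcpos _) (hcδ e)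
    refine abs_le_of_sq_le_sq' ?_ (by positivity) |>.2
    rw [mul_pow, mul_pow, Real.sq_sqrt (by positivity), hw₀, hu₀, norm_neg,
      norm_toLp_sq (Γ.len_pos e).le, norm_toLp_sq (Γ.len_pos e).le]
    exact h1
  have hw_le' : ∀ e, ‖w₀ e‖ ≤ ‖(((√K * δ : ℝ) : ℂ) • u₀) e‖ := fun e => by
    rw [Pi.smul_apply, norm_smul, Complex.norm_real, Real.norm_of_nonneg (by positivity)]
    exact hw_le e
  have hw_mem : Memℓp w₀ 2 := (hu_mem.const_smul ((√K * δ : ℝ) : ℂ)).mono' hw_le'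
  refine ⟨⟨u₀, hu_mem⟩, ⟨w₀, hw_mem⟩, ⟨g, hf.holds_cutoff hW c, fun e => (hgLp e).coeFn_toLp,
    fun e => ?_⟩, fun h0 => ?_, ?_⟩
  · change ⇑(w₀ e + (lam : ℂ) • u₀ e) =ᵐ[_] _
    filter_upwards [Lp.coeFn_add (w₀ e) ((lam : ℂ) • u₀ e), Lp.coeFn_smul (lam : ℂ) (u₀ e),
      (hgLp e).coeFn_toLp, Lp.coeFn_neg (hwLp e).toLp, (hwLp e).coeFn_toLp] with x h1 h2 h3 h4 h5
    rw [h1, Pi.add_apply, h2, Pi.smul_apply, h3, h4, Pi.neg_apply, h5]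
    simp only [hg, cutoff, smul_eq_mul]
    ring
  -- The damping factor is positive everywhere, and a continuous function that vanishes almost
  -- everywhere on an edge vanishes at each of its points.
  · obtain ⟨e, x, hx, hfx⟩ := hne
    have h1 : u₀ e = 0 := congrFun (congrArg Subtype.val h0) e
    have h2 : g.toFun e =ᵐ[Γ.edgeMeasure e] fun _ => 0 := by
      refine (hgLp e).coeFn_toLp.symm.trans ?_
      change ⇑(u₀ e) =ᵐ[_] _
      rw [h1]
      exact Lp.coeFn_zero ..
    have h3 := Measure.eqOn_Icc_of_ae_eq (μ := volume) (Γ.len_pos e).ne h2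
      (g.continuousOn_toFun e) continuousOn_const hx
    have h4 := (step_mem (c₀ := c (Γ.endpt e false)) (c₁ := c (Γ.endpt e true))
      (Γ.len_pos e) hx).1
    have h5 := (lt_min (hcpos (Γ.endpt e false)) (hcpos (Γ.endpt e true))).trans_le h4
    exact mul_ne_zero (Complex.ofReal_ne_zero.2 h5.ne') hfx h3
  · have h1 := lp.norm_mono (p := 2) two_ne_zero (x := (⟨w₀, hw_mem⟩ : Γ.L2))
      (y := ((√K * δ : ℝ) : ℂ) • (⟨u₀, hu_mem⟩ : Γ.L2)) hw_le'
    rwa [norm_smul, Complex.norm_real, Real.norm_of_nonneg (by positivity)] at h1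

end MetricGraph

end QuantumGraphs

open QuantumGraphs in
theorem corollary3p2 {V E : Type*} [Infinite V] (Γ : MetricGraph V E) (hA : Γ.ConditionA) (o : V)
    (W : Γ.SelfAdjointVertexConditions) (hgrowth : Γ.SubexponentialGrowth o) (lam : ℝ)
    (φ : Γ.EdgewiseH2) (hvertex : W.Holds φ) (hsol : φ.IsSolution lam)
    (hbdd : φ.IsBounded) (hne : φ.IsNonzero) :
    (lam : ℂ) ∈ spectrumOf W.hamiltonian := by
  intro hz
  obtain ⟨C, hC, hR⟩ := MetricGraph.SelfAdjointVertexConditions.norm_le_of_mem_resolventSetOf hz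
  obtain ⟨l₀, L, hl₀, hl⟩ := hA
  obtain ⟨M, hM⟩ := hbdd
  have hL0 : 0 < L := by
    obtain ⟨e, -⟩ := hne
    exact hl₀.trans_le ((hl e).1.trans (hl e).2)
  set K := √(1224 / l₀ ^ 4 + 576 * |lam| / l₀ ^ 2) with hK
  have hK0 : 0 ≤ K := Real.sqrt_nonneg _
  have hCK : 0 < C * K + 1 := by positivity
  -- With `δ = 1 / (C K + 1)` the product `C K δ` is less than `1`, so `‖u‖ ≤ C ‖w‖ ≤ C K δ ‖u‖`
  -- contradicts `u ≠ 0`. The summand `1` covers the case `C = 0`.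
  obtain ⟨u, w, huw, hu, hw⟩ := hsol.exists_approximate_eigenvector hl₀ hL0 (fun e => (hl e).1)
    (fun e => (hl e).2) hgrowth hvertex hM hne (inv_pos.2 hCK)
  have hu0 : 0 < ‖u‖ := norm_pos_iff.2 hu
  have h1 : ‖u‖ ≤ C * (K * (C * K + 1)⁻¹ * ‖u‖) :=
    (hR u w huw).trans (mul_le_mul_of_nonneg_left hw hC)
  have h2 : C * K * (C * K + 1)⁻¹ < 1 := by
    rw [← div_eq_mul_inv, div_lt_one hCK]
    linarith
  nlinarith
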